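/- Let $n\ge 2$. For $x\in\mathbb{C}^n$ write $x\cdot x=\sum_j x_j^2$, $\langle\theta,x\rangle=\sum_j\theta_jx_j$ for $\theta\in\mathbb{S}^{n-1}\subset\mathbb{R}^n$, $\|x\|^2=\sum_j|x_j|^2$, and let $$L(x)=\Big(\|x\|^2+\sqrt{\|x\|^4-|x\cdot x|^2}\Big)^{1/2}$$ be the Lie norm, whose open unit ball is the Lie ball (Cartan's fourth domain). For $\zeta\in\mathbb{C}$ with $|\zeta|>L(x)$ put $$r(\zeta\theta-x)=\zeta\Big(1-\frac{2\langle\theta,x\rangle}{\zeta}+\frac{x\cdot x}{\zeta^2}\Big)^{1/2}$$ with the principal square root, so that $r(\zeta\theta-x)^2=\zeta^2-2\zeta\langle\theta,x\rangle+x\cdot x$ and $r(\zeta\theta)=\zeta$. Then $r(\zeta\theta-x)$ is continuous in $(\zeta,\theta,x)$ and has no zeros on the set $\{|\zeta|>L(x)\}$, and for every polynomial $P$ on $\mathbb{C}^n$ with complex coefficients, every $x\in\mathbb{C}^n$ and every $R>L(x)$, $$P(x)=\frac{1}{2\pi i}\oint_{|\zeta|=R}\int_{\mathbb{S}^{n-1}}\frac{\zeta^{n-1}}{r(\zeta\theta-x)^n}\,P(\zeta\theta)\,d\theta\,d\zeta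 ,$$ where $d\theta$ is the rotation-invariant surface measure on $\mathbb{S}^{n-1}$ of total mass $1$. In particular ($R=1$), for all $x$ in the Lie ball the formula holds with the integral over $\mathbb{S}^1\times\mathbb{S}^{n-1}$. -/

import Mathlib

open MeasureTheory

noncomputable section

/-- The real unit sphere `𝕊^{n-1}` of `ℝⁿ`. -/
abbrev RealSphere (n : ℕ) : Type := Metric.sphere (0 : EuclideanSpace ℝ (Fin n)) 1

/-- The complex bilinear extension `x · x = ∑ xⱼ²` to `ℂⁿ` of the function `|x|²` on `ℝⁿ`. -/
def bilinSq {n : ℕ} (x : EuclideanSpace ℂ (Fin n)) : ℂ := ∑ j, x j ^ 2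

/-- The scalar product `⟨θ, x⟩ = ∑ θⱼ xⱼ` of a real unit vector `θ` and `x ∈ ℂⁿ`. -/
def realPairing {n : ℕ} (θ : RealSphere n) (x : EuclideanSpace ℂ (Fin n)) : ℂ :=
  ∑ j, (θ.1 j : ℂ) * x j

/-- The Lie norm `L(x) = (‖x‖² + (‖x‖⁴ - |x · x|²)^{1/2})^{1/2}` on `ℂⁿ`. Its open unit ball
is the Lie ball (the fourth domain of Cartan). -/
def lieNorm {n : ℕ} (x : EuclideanSpace ℂ (Fin n)) : ℝ :=
  Real.sqrt (‖x‖ ^ 2 + Real.sqrt (‖x‖ ^ 4 - ‖bilinSq x‖ ^ 2))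

/-- The root `r(ζθ - x)` of `ζ² - 2ζ⟨θ, x⟩ + x · x`, written as
`ζ (1 - 2ζ⁻¹⟨θ, x⟩ + ζ⁻² x · x)^{1/2}` with the principal square root (used for `ζ ≠ 0`).
This is the branch that equals `ζ` at `x = 0`. -/
def aronszajnRoot {n : ℕ} (ζ : ℂ) (θ : RealSphere n) (x : EuclideanSpace ℂ (Fin n)) : ℂ :=
  ζ * (1 - 2 * realPairing θ x / ζ + bilinSq x / ζ ^ 2) ^ (1 / 2 : ℂ)

/-- The Hua–Aronszajn kernel `ζ^{n-1} / r(ζθ - x)^n`. -/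
def huaAronszajnKernel {n : ℕ} (ζ : ℂ) (θ : RealSphere n) (x : EuclideanSpace ℂ (Fin n)) : ℂ :=
  ζ ^ (n - 1) / aronszajnRoot ζ θ x ^ n

theorem aronszajnRoot_sq {n : ℕ} {ζ : ℂ} (hζ : ζ ≠ 0) (θ : RealSphere n)
    (x : EuclideanSpace ℂ (Fin n)) :
    aronszajnRoot ζ θ x ^ 2 = ζ ^ 2 - 2 * ζ * realPairing θ x + bilinSq x := by
  have h (w : ℂ) : (w ^ (1 / 2 : ℂ)) ^ 2 = w := by
    rw [← Complex.cpow_nat_mul]; norm_num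
  rw [aronszajnRoot, mul_pow, h]
  field_simp

theorem aronszajnRoot_zero {n : ℕ} (ζ : ℂ) (θ : RealSphere n) :
    aronszajnRoot ζ θ 0 = ζ := by
  simp [aronszajnRoot, realPairing, bilinSq]

end

noncomputable section

/-! Put D(t) = 2t⟨θ,x⟩ - t²(x·x). The kernel is ζ⁻¹(1 - D(1/ζ))^(-n/2), and a homogeneous component
p of P of degree k satisfies p(ζθ) = ζ^k p(θ). The contour integral therefore extracts the
coefficient of t^k in the binomial series, ∑ₘ cₘ [t^k] D^m with cₘ = Γ(n/2+m) / (m! Γ(n/2)).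

As a polynomial in θ, p · [t^k] D^m has degree (2m - k) + k = 2m. In polar coordinates the Gaussian
mean of such a polynomial is Γ(n/2+m) / Γ(n/2) times its spherical mean
(`choose_mul_average_toSphere_evalReal`). The Gamma factors cancel, the binomial series becomes the
exponential series, and what remains is the Gaussian mean of p · [t^k] exp D. Completing the square
explains its value: weighting by exp(2t⟨y,x⟩ - t²(x·x)) translates the Gaussian by tx, and the
coefficient of t^k in p(y + tx) is p(x). `apply_hermite_mul` proves this algebraically, by Gaussian
integration by parts.

The branch is controlled by `norm_le_lieNorm_of_root`: for |ζ| > L(x) the radicand is (1 - α)(1 - β)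
with |α|, |β| < 1, so it avoids the cut. The kernel is then holomorphic in ζ there, and the contour
can be pushed out to where the binomial series applies. -/

open Finset in
/-- Leibniz rule for a derivation applied to the coefficients of a product of polynomials. -/
theorem Derivation.apply_coeff_mul {R B : Type*} [CommRing R] [CommRing B] [Algebra R B]
    (d : Derivation R B B) {p q p' q' : Polynomial B} (hp : ∀ k, d (p.coeff k) = p'.coeff k)
    (hq : ∀ k, d (q.coeff k) = q'.coeff k) (k : ℕ) :
    d ((p * q).coeff k) = (p * q' + p' * q).coeff k := by
  simp only [Polynomial.coeff_mul, map_sum, Derivation.leibniz, hp, hq, smul_eq_mul,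
    Polynomial.coeff_add, ← sum_add_distrib]
  exact sum_congr rfl fun _ _ => by ring

/-- Allows differentiation in the variables y, coefficient by coefficient, while t stays formal. -/
theorem Derivation.apply_coeff_pow_succ {R B : Type*} [CommRing R] [CommRing B] [Algebra R B]
    (d : Derivation R B B) {p p' : Polynomial B} (hp : ∀ k, d (p.coeff k) = p'.coeff k)
    (m k : ℕ) : d ((p ^ (m + 1)).coeff k) = (((m : Polynomial B) + 1) * p ^ m * p').coeff k := by
  induction m generalizing k with
  | zero => simp [hp]
  | succ m ih =>
    rw [pow_succ, d.apply_coeff_mul ih hp]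
    congr 1
    push_cast
    ring

/-! ### Hermite polynomials and Gaussian integration by parts -/

namespace HuaAronszajn

open MvPolynomial Finset

variable {σ : Type*} [Fintype σ]

/-- The linear form `y ↦ ∑ xⱼ yⱼ`. -/
def linearForm (x : σ → ℂ) : MvPolynomial σ ℂ := ∑ j, C (x j) * X j

/-- The exponent `2 t ⟨y, x⟩ - t² (x · x)` of the Hermite generating function, as a polynomial in
`t` whose coefficients are polynomials in `y`. -/
def hermiteExponent (x : σ → ℂ) : Polynomial (MvPolynomial σ ℂ) :=
  Polynomial.C (2 * linearForm x) * Polynomial.X - Polynomial.C (C (∑ j, x j ^ 2)) * Polynomial.X ^ 2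

/-- The coefficient of `t ^ k` in `exp (2 t ⟨y, x⟩ - t² (x · x))`, a polynomial in `y`. -/
def hermite (x : σ → ℂ) (k : ℕ) : MvPolynomial σ ℂ :=
  ∑ m ∈ range (k + 1), C ((m.factorial : ℂ)⁻¹) * (hermiteExponent x ^ m).coeff k

/-- The exponent is divisible by t. Hence the exponential series is a finite sum in each degree and
may be cut off at any larger index. -/
theorem coeff_hermiteExponent_pow_eq_zero (x : σ → ℂ) {m k : ℕ} (h : k < m) :
    (hermiteExponent x ^ m).coeff k = 0 := by
  have : hermiteExponent x =
      Polynomial.X * (Polynomial.C (2 * linearForm x) - Polynomial.C (C (∑ j, x j ^ 2)) * Polynomial.X) := by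
    rw [hermiteExponent]; ring
  rw [this, mul_pow, Polynomial.coeff_X_pow_mul', if_neg (by omega)]

theorem hermite_eq_sum (x : σ → ℂ) {k N : ℕ} (h : k < N) :
    hermite x k = ∑ m ∈ range N, C ((m.factorial : ℂ)⁻¹) * (hermiteExponent x ^ m).coeff k := by
  rw [hermite]
  refine sum_subset (by simpa using h) fun m _ hm => ?_
  rw [coeff_hermiteExponent_pow_eq_zero x (by simpa using hm), mul_zero]

theorem hermite_zero (x : σ → ℂ) : hermite x 0 = 1 := by simp [hermite]

theorem hermite_one (x : σ → ℂ) : hermite x 1 = 2 * linearForm x := by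
  simp only [hermite, hermiteExponent]
  generalize ∑ j, x j ^ 2 = A
  simp [sum_range_succ, Polynomial.coeff_one]

theorem C_inv_factorial_succ_mul {τ : Type*} (m : ℕ) :
    C (((m + 1).factorial : ℂ)⁻¹) * ((m : MvPolynomial τ ℂ) + 1) = C ((m.factorial : ℂ)⁻¹) := by
  have h : (m : ℂ) + 1 ≠ 0 := by exact_mod_cast m.succ_ne_zero
  rw [show (m : MvPolynomial τ ℂ) + 1 = C ((m : ℂ) + 1) by simp, ← C_mul, Nat.factorial_succ]
  congr 1
  push_cast
  field_simp

/-- Compares the coefficients of t^(k+1) in ∂ₜ exp D = D' exp D, where D' = 2⟨y,x⟩ - 2t(x·x). -/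
theorem hermite_add_two (x : σ → ℂ) (k : ℕ) :
    ((k : MvPolynomial σ ℂ) + 2) * hermite x (k + 2) =
      2 * linearForm x * hermite x (k + 1) - 2 * C (∑ j, x j ^ 2) * hermite x k := by
  have key (m : ℕ) : ((k : MvPolynomial σ ℂ) + 2) * (hermiteExponent x ^ (m + 1)).coeff (k + 2) =
      ((m : MvPolynomial σ ℂ) + 1) * (2 * linearForm x * (hermiteExponent x ^ m).coeff (k + 1) -
        2 * C (∑ j, x j ^ 2) * (hermiteExponent x ^ m).coeff k) := by
    have h := congrArg (fun p => p.coeff (k + 1))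
      (Polynomial.derivative_pow_succ (hermiteExponent x) m)
    have hD : Polynomial.derivative (hermiteExponent x) = Polynomial.C (2 * linearForm x) -
        Polynomial.C (2 * C (∑ j, x j ^ 2)) * Polynomial.X := by
      rw [hermiteExponent]
      generalize ∑ j, x j ^ 2 = A
      simp [show (Polynomial.C 2 : Polynomial (MvPolynomial σ ℂ)) = 2 from map_ofNat _ 2]
      ring
    rw [hD] at h
    have e : Polynomial.C ((m : MvPolynomial σ ℂ) + 1) * hermiteExponent x ^ m *
        (Polynomial.C (2 * linearForm x) -
          Polynomial.C (2 * C (∑ j, x j ^ 2)) * Polynomial.X) =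
        Polynomial.C ((m : MvPolynomial σ ℂ) + 1) *
          (Polynomial.C (2 * linearForm x) * hermiteExponent x ^ m -
          Polynomial.C (2 * C (∑ j, x j ^ 2)) * (hermiteExponent x ^ m * Polynomial.X)) := by ring
    simp only [e, Polynomial.coeff_derivative, Polynomial.coeff_C_mul, Polynomial.coeff_sub,
      Polynomial.coeff_mul_X] at h
    rw [← h]
    push_cast
    ring
  -- The cutoffs are chosen so that, once the vanishing term m = 0 is dropped on the left, all three
  -- sums run over `range (k + 2)`.
  rw [hermite_eq_sum x (show k + 2 < k + 3 by omega), hermite_eq_sum x (show k + 1 < k + 2 by omega),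
    hermite_eq_sum x (show k < k + 2 by omega), sum_range_succ', mul_add, mul_sum, mul_sum, mul_sum,
    ← sum_sub_distrib]
  simp only [pow_zero, Polynomial.coeff_one, show ¬ (k + 2 = 0) by omega, if_false, mul_zero, add_zero]
  refine sum_congr rfl fun m _ => ?_
  rw [← C_inv_factorial_succ_mul m]
  linear_combination C (((m + 1).factorial : ℂ)⁻¹) * key m

theorem pderiv_linearForm [DecidableEq σ] (x : σ → ℂ) (i : σ) : pderiv i (linearForm x) = C (x i) := by
  simp [linearForm, pderiv_X, Pi.single_apply]

/-- Compares coefficients in ∂ᵢ exp D = 2t xᵢ exp D, the derivative being taken in yᵢ. -/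
theorem pderiv_hermite_succ (x : σ → ℂ) (i : σ) (k : ℕ) :
    pderiv i (hermite x (k + 1)) = 2 * C (x i) * hermite x k := by
  classical
  have hd (k : ℕ) : pderiv i ((hermiteExponent x).coeff k) =
      (Polynomial.C (2 * C (x i)) * Polynomial.X : Polynomial (MvPolynomial σ ℂ)).coeff k := by
    rw [hermiteExponent, Polynomial.coeff_sub, Polynomial.coeff_C_mul, Polynomial.coeff_C_mul,
      Polynomial.coeff_C_mul, Polynomial.coeff_X, Polynomial.coeff_X_pow]
    have h2 : pderiv i (2 : MvPolynomial σ ℂ) = 0 := by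
      rw [show (2 : MvPolynomial σ ℂ) = C 2 from (map_ofNat C 2).symm, pderiv_C]
    split_ifs <;> simp [pderiv_linearForm, Derivation.leibniz, h2]
  have key (m : ℕ) : pderiv i ((hermiteExponent x ^ (m + 1)).coeff (k + 1)) =
      ((m : MvPolynomial σ ℂ) + 1) * (2 * C (x i)) * (hermiteExponent x ^ m).coeff k := by
    rw [Derivation.apply_coeff_pow_succ _ hd]
    have e : ((m : Polynomial (MvPolynomial σ ℂ)) + 1) * hermiteExponent x ^ m *
        (Polynomial.C (2 * C (x i)) * Polynomial.X) =
        Polynomial.C (((m : MvPolynomial σ ℂ) + 1) * (2 * C (x i))) *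
          (hermiteExponent x ^ m * Polynomial.X) := by
      simp only [map_mul, map_add, map_natCast, map_one]
      ring
    rw [e, Polynomial.coeff_C_mul, Polynomial.coeff_mul_X]
  rw [hermite, sum_range_succ', map_add, map_sum, hermite, mul_sum]
  simp only [pow_zero, Polynomial.coeff_one, show ¬ (k + 1 = 0) by omega, if_false, mul_zero, map_zero, add_zero]
  refine sum_congr rfl fun m _ => ?_
  rw [pderiv_C_mul, key, ← C_inv_factorial_succ_mul m]
  ring

/-- A linear functional on polynomials that satisfies the Gaussian integration by parts formula
`E (yᵢ p) = E (∂ᵢ p) / 2` pairs the Hermite polynomial of degree `k` with a homogeneous polynomial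
`p` of degree at most `k` to `p(x) E(1)` or `0`. -/
theorem apply_hermite_mul (E : MvPolynomial σ ℂ →ₗ[ℂ] ℂ)
    (hE : ∀ i p, E (X i * p) = 1 / 2 * E (pderiv i p)) (x : σ → ℂ) (d : ℕ) :
    ∀ (k : ℕ) (p : MvPolynomial σ ℂ), d ≤ k → p.IsHomogeneous d →
      E (hermite x k * p) = if d = k then eval x p * E 1 else 0 := by
  have hC (c : ℂ) (p) : E (C c * p) = c * E p := by rw [← smul_eq_C_mul, map_smul, smul_eq_mul]
  -- Hermite polynomials of positive degree have mean zero: by parts, the mean of 2⟨y,x⟩ H_(k+1) is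
  -- 2(x·x) E(H_k), which cancels the other term of the recurrence.
  have h1 (k : ℕ) : E (hermite x (k + 1)) = 0 := by
    cases k with
    | zero =>
      have h2 : (2 : MvPolynomial σ ℂ) = C 2 := (map_ofNat C 2).symm
      have h0 (i) : E (X i) = 0 := by simpa using hE i 1
      simp [hermite_one, linearForm, h2, hC, h0]
    | succ k =>
      have h2 : (2 : MvPolynomial σ ℂ) = C 2 := (map_ofNat C 2).symm
      have h : E (((k : MvPolynomial σ ℂ) + 2) * hermite x (k + 2)) = 0 := by
        rw [hermite_add_two, map_sub, mul_assoc, mul_assoc, linearForm, h2, hC, hC, hC, sum_mul,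
          map_sum]
        simp only [mul_assoc, hC, hE, pderiv_hermite_succ, h2]
        rw [sum_mul]
        simp only [mul_sum, ← sum_sub_distrib]
        exact sum_eq_zero fun i _ => by ring
      have e : ((k : MvPolynomial σ ℂ) + 2) = C ((k : ℂ) + 2) := by simp [h2]
      rw [e, hC] at h
      refine (mul_eq_zero.1 h).resolve_left ?_
      exact_mod_cast (k + 1).succ_ne_zero
  induction d using Nat.strong_induction_on with
  | _ d ih =>
    intro k p hdk hp
    have h2 : (2 : MvPolynomial σ ℂ) = C 2 := (map_ofNat C 2).symm
    rcases d with _ | d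
    · obtain ⟨c, rfl⟩ : ∃ c, p = C c := ⟨_, totalDegree_eq_zero_iff_eq_C.1 (hp.totalDegree_le.antisymm zero_le)⟩
      rw [mul_comm, hC]
      rcases k with _ | k
      · simp [hermite_zero]
      · simp [h1]
    · obtain ⟨k, rfl⟩ : ∃ k', k = k' + 1 := ⟨k - 1, by omega⟩
      -- Euler's identity writes (d+1)p as ∑ yᵢ ∂ᵢp, which supplies the factor yᵢ needed for
      -- integration by parts.
      have euler := hp.sum_X_mul_pderiv
      have hp' (i) : (pderiv i p).IsHomogeneous d := by simpa using hp.pderiv (i := i)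
      have step (i) : E (hermite x (k + 1) * (X i * pderiv i p)) =
          if d = k then x i * eval x (pderiv i p) * E 1 else 0 := by
        rw [mul_left_comm, hE, Derivation.leibniz, map_add, smul_eq_mul, smul_eq_mul,
          pderiv_hermite_succ, show pderiv i p * (2 * C (x i) * hermite x k) =
            C 2 * (C (x i) * (hermite x k * pderiv i p)) by rw [h2]; ring, hC, hC,
          ih d (by omega) k _ (by omega) (hp' i)]
        -- The second derivative has degree below k + 1. This drop by two degrees is why the
        -- induction is strong.
        have z : E (hermite x (k + 1) * pderiv i (pderiv i p)) = 0 := by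
          rcases d with _ | d
          · obtain ⟨c, hc⟩ : ∃ c, pderiv i p = C c :=
              ⟨_, totalDegree_eq_zero_iff_eq_C.1 ((hp' i).totalDegree_le.antisymm zero_le)⟩
            simp [hc]
          · rw [ih d (by omega) (k + 1) _ (by omega) (by simpa using (hp' i).pderiv (i := i)),
              if_neg (by omega)]
        rw [z]
        split_ifs <;> ring
      have hsum : E (hermite x (k + 1) * ((d + 1) • p)) =
          if d = k then eval x ((d + 1) • p) * E 1 else 0 := by
        rw [← euler, mul_sum, map_sum, sum_congr rfl fun i _ => step i]
        split_ifs <;> simp [sum_mul]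
      rw [mul_smul_comm, map_nsmul, nsmul_eq_mul, nsmul_eq_mul, map_mul (eval x), map_natCast] at hsum
      have hd0 : ((d + 1 : ℕ) : ℂ) ≠ 0 := by exact_mod_cast d.succ_ne_zero
      apply mul_left_cancel₀ hd0
      rw [hsum]
      simp only [Nat.add_right_cancel_iff]
      split_ifs <;> ring

end HuaAronszajn

/-! ### Gaussian integrals and spherical means -/

namespace HuaAronszajn

open MvPolynomial Finset

variable {n : ℕ}

/-- Evaluation of a polynomial with complex coefficients at a real vector. -/
def evalReal (p : MvPolynomial (Fin n) ℂ) (y : EuclideanSpace ℝ (Fin n)) : ℂ :=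
  eval (fun j => (y j : ℂ)) p

theorem continuous_evalReal (p : MvPolynomial (Fin n) ℂ) : Continuous (evalReal p) := by
  unfold evalReal
  exact (MvPolynomial.continuous_eval p).comp (by fun_prop)

theorem hasLineDerivAt_evalReal (p : MvPolynomial (Fin n) ℂ) (i : Fin n)
    (y : EuclideanSpace ℝ (Fin n)) :
    HasLineDerivAt ℝ (evalReal p) (evalReal (pderiv i p) y) y (EuclideanSpace.single i 1) := by
  unfold HasLineDerivAt
  induction p using MvPolynomial.induction_on with
  | C a => simpa [evalReal] using hasDerivAt_const (0 : ℝ) a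
  | add p q hp hq =>
    convert! hp.add hq using 1
    · funext t; simp [evalReal]
    · simp [evalReal]
  | mul_X p j hp =>
    have h : HasDerivAt (fun t : ℝ => (((y + t • EuclideanSpace.single i (1 : ℝ)) j : ℝ) : ℂ))
        (Pi.single (M := fun _ => ℂ) i 1 j) 0 := by
      have h1 : HasDerivAt (fun t : ℝ => y j + t * (Pi.single (M := fun _ => ℝ) i 1 j))
        (1 * Pi.single (M := fun _ => ℝ) i 1 j) 0 := ((hasDerivAt_id (0 : ℝ)).mul_const _).const_add _
      convert! h1.ofReal_comp using 1
      by_cases hij : j = i <;> simp [hij]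
    convert! hp.mul h using 1
    · funext t; simp [evalReal]
    · by_cases hij : j = i
      · subst hij; simp [evalReal, Derivation.leibniz]; ring
      · simp [evalReal, pderiv_X, Derivation.leibniz, hij, mul_comm]

theorem norm_evalReal_monomial_le (s : Fin n →₀ ℕ) (c : ℂ) (y : EuclideanSpace ℝ (Fin n)) :
    ‖evalReal (monomial s c) y‖ ≤ ‖c‖ * ‖y‖ ^ s.degree := by
  rw [evalReal, eval_monomial, norm_mul, Finsupp.prod, norm_prod, Finsupp.degree_apply, ← prod_pow_eq_pow_sum]
  gcongr with j
  rw [norm_pow]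
  gcongr
  simpa using PiLp.norm_apply_le y j

theorem integrable_pow_norm_mul_exp (hn : 0 < n) (d : ℕ) :
    Integrable fun y : EuclideanSpace ℝ (Fin n) => ‖y‖ ^ d * Real.exp (-‖y‖ ^ 2) := by
  have : Nonempty (Fin n) := ⟨⟨0, hn⟩⟩
  refine (integrable_fun_norm_addHaar (f := fun r => r ^ d * Real.exp (-r ^ 2)) volume).2 ?_
  have h := integrableOn_rpow_mul_exp_neg_mul_sq one_pos (s := ((n - 1 + d : ℕ) : ℝ))
    (by linarith [(Nat.cast_nonneg (n - 1 + d) : (0 : ℝ) ≤ _)])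
  refine h.congr_fun (fun r _ => ?_) measurableSet_Ioi
  simp only [Real.rpow_natCast, finrank_euclideanSpace, Fintype.card_fin, smul_eq_mul, pow_add]
  ring_nf

theorem integrable_evalReal_mul_exp (hn : 0 < n) (p : MvPolynomial (Fin n) ℂ) :
    Integrable fun y : EuclideanSpace ℝ (Fin n) => evalReal p y * (Real.exp (-‖y‖ ^ 2) : ℂ) := by
  induction p using MvPolynomial.induction_on' with
  | monomial s c =>
    refine ((integrable_pow_norm_mul_exp hn s.degree).const_mul ‖c‖).mono' ?_ (.of_forall fun y => ?_)
    · exact ((continuous_evalReal _).mul (by fun_prop)).aestronglyMeasurable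
    · rw [norm_mul, Complex.norm_real, Real.norm_of_nonneg (Real.exp_pos _).le, ← mul_assoc]
      gcongr
      exact norm_evalReal_monomial_le s c y
  | add p q hp hq =>
    refine (hp.add hq).congr (.of_forall fun y => ?_)
    simp [evalReal, add_mul]

/-- The unnormalized Gaussian expectation `p ↦ ∫ p(y) exp (-|y|²) dy`. -/
def gaussianFunctional (hn : 0 < n) : MvPolynomial (Fin n) ℂ →ₗ[ℂ] ℂ where
  toFun p := ∫ y : EuclideanSpace ℝ (Fin n), evalReal p y * (Real.exp (-‖y‖ ^ 2) : ℂ)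
  map_add' p q := by
    rw [← integral_add (integrable_evalReal_mul_exp hn p) (integrable_evalReal_mul_exp hn q)]
    simp [evalReal, add_mul]
  map_smul' c p := by
    rw [RingHom.id_apply, smul_eq_mul, ← integral_const_mul]
    simp [evalReal, mul_assoc]

/-- Integration by parts against exp(-|y|²), whose i-th derivative is -2yᵢ exp(-|y|²). -/
theorem gaussianFunctional_X_mul (hn : 0 < n) (i : Fin n) (p : MvPolynomial (Fin n) ℂ) :
    gaussianFunctional hn (X i * p) = 1 / 2 * gaussianFunctional hn (pderiv i p) := by
  have hg (y : EuclideanSpace ℝ (Fin n)) : HasLineDerivAt ℝ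
      (fun y : EuclideanSpace ℝ (Fin n) => (Real.exp (-‖y‖ ^ 2) : ℂ))
      (-2 * y i * (Real.exp (-‖y‖ ^ 2) : ℂ)) y (EuclideanSpace.single i 1) := by
    have h1 : HasFDerivAt (fun y : EuclideanSpace ℝ (Fin n) => -‖y‖ ^ 2) (-(2 • innerSL ℝ y)) y :=
      (hasStrictFDerivAt_norm_sq y).hasFDerivAt.neg
    have h2 := (h1.exp.hasLineDerivAt (EuclideanSpace.single i 1))
    have h3 := HasDerivAt.ofReal_comp h2
    unfold HasLineDerivAt
    convert! h3 using 1
    simp [EuclideanSpace.inner_single_right]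
    ring
  have e (y : EuclideanSpace ℝ (Fin n)) : evalReal p y * (-2 * y i * (Real.exp (-‖y‖ ^ 2) : ℂ)) =
      -2 * (evalReal (X i * p) y * (Real.exp (-‖y‖ ^ 2) : ℂ)) := by
    simp [evalReal]; ring
  have key := integral_bilinear_hasLineDerivAt_right_eq_neg_left_of_integrable
    (μ := (volume : Measure (EuclideanSpace ℝ (Fin n)))) (B := ContinuousLinearMap.mul ℝ ℂ)
    (f := evalReal p) (f' := evalReal (pderiv i p)) (v := EuclideanSpace.single i 1)
    (g := fun y : EuclideanSpace ℝ (Fin n) => (Real.exp (-‖y‖ ^ 2) : ℂ))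
    (g' := fun y => -2 * y i * (Real.exp (-‖y‖ ^ 2) : ℂ))
    (by simpa using integrable_evalReal_mul_exp hn (pderiv i p))
    (by
      simp only [ContinuousLinearMap.mul_apply', e]
      exact (integrable_evalReal_mul_exp hn (X i * p)).const_mul _)
    (by simpa using integrable_evalReal_mul_exp hn p)
    (fun y _ => hasLineDerivAt_evalReal p i y) (fun y _ => hg y)
  simp only [ContinuousLinearMap.mul_apply', e] at key
  rw [integral_const_mul] at key
  change ∫ y : EuclideanSpace ℝ (Fin n), evalReal (X i * p) y * (Real.exp (-‖y‖ ^ 2) : ℂ) =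
    1 / 2 * ∫ y : EuclideanSpace ℝ (Fin n), evalReal (pderiv i p) y * (Real.exp (-‖y‖ ^ 2) : ℂ)
  linear_combination (-1 / 2) * key

/-- Polar coordinates: homogeneity splits f into r^d and its values on the sphere, and the volume
element contributes r^(dim - 1). -/
theorem integral_mul_norm_eq {E : Type*} [NormedAddCommGroup E] [NormedSpace ℝ E]
    [FiniteDimensional ℝ E] [Nontrivial E] [MeasurableSpace E] [BorelSpace E] (μ : Measure E)
    [μ.IsAddHaarMeasure] (f : E → ℂ) (g : ℝ → ℂ) (d : ℕ)
    (hf : ∀ (r : ℝ) (y : E), 0 < r → f (r • y) = (r : ℂ) ^ d * f y) :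
    ∫ y, f y * g ‖y‖ ∂μ = (∫ θ, f θ.1 ∂μ.toSphere) *
      ∫ r in Set.Ioi (0 : ℝ), (r : ℂ) ^ (Module.finrank ℝ E - 1 + d) * g r := by
  calc
    _ = ∫ y : ({(0)}ᶜ : Set E), f y.1 * g ‖y.1‖ ∂(μ.comap (↑)) := by
      rw [integral_subtype_comap (measurableSet_singleton _).compl fun y => f y * g ‖y‖,
        restrict_compl_singleton]
    _ = ∫ z : Metric.sphere (0 : E) 1 × Set.Ioi (0 : ℝ), f z.1.1 * ((z.2.1 : ℂ) ^ d * g z.2.1)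
          ∂μ.toSphere.prod (.volumeIoiPow (Module.finrank ℝ E - 1)) := by
      rw [← μ.measurePreserving_homeomorphUnitSphereProd.integral_comp
        (Homeomorph.measurableEmbedding _)]
      refine integral_congr_ae (.of_forall fun y => ?_)
      have hy : 0 < ‖y.1‖ := norm_pos_iff.2 y.2
      have : y.1 = ‖y.1‖ • (‖y.1‖⁻¹ • y.1) := by rw [smul_inv_smul₀ hy.ne']
      simp only [homeomorphUnitSphereProd_apply_fst_coe, homeomorphUnitSphereProd_apply_snd_coe]
      conv_lhs => rw [this, hf _ _ hy]
      rw [← this]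
      ring
    _ = (∫ θ, f θ.1 ∂μ.toSphere) *
        ∫ r : Set.Ioi (0 : ℝ), (r.1 : ℂ) ^ d * g r ∂.volumeIoiPow (Module.finrank ℝ E - 1) :=
      integral_prod_mul (fun θ : Metric.sphere (0 : E) 1 => f θ.1)
        fun r : Set.Ioi (0 : ℝ) => (r.1 : ℂ) ^ d * g r
    _ = _ := by
      congr 1
      simp only [Measure.volumeIoiPow, ENNReal.ofReal]
      rw [integral_withDensity_eq_integral_smul,
        integral_subtype_comap measurableSet_Ioi fun a : ℝ =>
          Real.toNNReal (a ^ (Module.finrank ℝ E - 1)) • ((a : ℂ) ^ d * g a),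
        setIntegral_congr_fun measurableSet_Ioi fun r hr => ?_]
      · simp only [NNReal.smul_def, Real.coe_toNNReal _ (pow_nonneg (Set.mem_Ioi.1 hr).le _),
          Complex.real_smul, Complex.ofReal_pow, pow_add, mul_assoc]
      · exact (measurable_subtype_coe.pow_const _).real_toNNReal

theorem integral_pow_mul_exp_neg_sq (d : ℕ) :
    ∫ r in Set.Ioi (0 : ℝ), (r : ℂ) ^ d * (Real.exp (-r ^ 2) : ℂ) =
      1 / 2 * Complex.Gamma ((d + 1) / 2) := by
  have h := integral_rpow_mul_exp_neg_rpow (p := 2) (q := d) two_pos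
    (by linarith [(Nat.cast_nonneg d : (0 : ℝ) ≤ _)])
  have e : ∀ r : ℝ, (r : ℂ) ^ d * (Real.exp (-r ^ 2) : ℂ) =
      ((r ^ (d : ℝ) * Real.exp (-r ^ (2 : ℝ)) : ℝ) : ℂ) := by
    intro r
    rw [Real.rpow_natCast, Real.rpow_two]
    push_cast
    ring
  simp only [e]
  rw [integral_complex_ofReal, h]
  push_cast [← Complex.Gamma_ofReal]
  rfl

/-- The radial factor is ∫ r^(n-1+2m) exp(-r²) dr = Γ(n/2+m)/2. Homogeneity is required only as
scaling at real vectors, so that it can be checked without the truncated exponent 2m - k. -/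
theorem gaussianFunctional_eq_integral_toSphere (hn : 0 < n) (p : MvPolynomial (Fin n) ℂ) (m : ℕ)
    (hp : ∀ (r : ℝ) (y : EuclideanSpace ℝ (Fin n)), 0 < r →
      evalReal p (r • y) = (r : ℂ) ^ (2 * m) * evalReal p y) :
    gaussianFunctional hn p = (∫ θ : RealSphere n, evalReal p θ.1
      ∂(volume : Measure (EuclideanSpace ℝ (Fin n))).toSphere) *
      (1 / 2 * Complex.Gamma ((n : ℂ) / 2 + m)) := by
  have : Nonempty (Fin n) := ⟨⟨0, hn⟩⟩
  have hn1 : ((n - 1 : ℕ) : ℂ) = n - 1 := by rw [Nat.cast_sub hn, Nat.cast_one]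
  refine (integral_mul_norm_eq volume (evalReal p) (fun r => (Real.exp (-r ^ 2) : ℂ))
    (2 * m) hp).trans ?_
  rw [integral_pow_mul_exp_neg_sq, finrank_euclideanSpace, Fintype.card_fin]
  congr 3
  push_cast [hn1]
  ring

theorem gaussianFunctional_one (hn : 0 < n) :
    gaussianFunctional hn 1 =
      ((volume : Measure (EuclideanSpace ℝ (Fin n))).toSphere.real Set.univ : ℂ) *
      (1 / 2 * Complex.Gamma ((n : ℂ) / 2)) := by
  have h := gaussianFunctional_eq_integral_toSphere hn 1 0 (by simp [evalReal])
  simpa only [evalReal, map_one, integral_const, Complex.real_smul, mul_one, Nat.cast_zero,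
    add_zero] using h

theorem Gamma_half_natCast_ne_zero (hn : 0 < n) : Complex.Gamma ((n : ℂ) / 2) ≠ 0 :=
  Complex.Gamma_ne_zero_of_re_pos (by simpa using hn)

theorem toSphere_real_univ_ne_zero (hn : 0 < n) :
    ((volume : Measure (EuclideanSpace ℝ (Fin n))).toSphere.real Set.univ : ℂ) ≠ 0 := by
  have : Nonempty (Fin n) := ⟨⟨0, hn⟩⟩
  rw [Complex.ofReal_ne_zero, measureReal_def, ENNReal.toReal_ne_zero]
  exact ⟨fun h => Measure.toSphere_ne_zero (volume : Measure (EuclideanSpace ℝ (Fin n)))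
    (Measure.measure_univ_eq_zero.1 h), measure_ne_top _ _⟩

theorem gaussianFunctional_one_ne_zero (hn : 0 < n) : gaussianFunctional hn 1 ≠ 0 := by
  rw [gaussianFunctional_one]
  exact mul_ne_zero (toSphere_real_univ_ne_zero hn)
    (mul_ne_zero (by norm_num) (Gamma_half_natCast_ne_zero hn))

/-- The surface mean of a polynomial that is homogeneous of degree `2m` on the sphere is a
multiple of its Gaussian expectation. -/
theorem choose_mul_average_toSphere_evalReal (hn : 0 < n) (p : MvPolynomial (Fin n) ℂ) (m : ℕ)
    (hp : ∀ (r : ℝ) (y : EuclideanSpace ℝ (Fin n)), 0 < r →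
      evalReal p (r • y) = (r : ℂ) ^ (2 * m) * evalReal p y) :
    Ring.choose ((n : ℂ) / 2 + m - 1) m *
      (⨍ θ : RealSphere n, evalReal p θ.1 ∂(volume : Measure (EuclideanSpace ℝ (Fin n))).toSphere) =
      (m.factorial : ℂ)⁻¹ * gaussianFunctional hn p / gaussianFunctional hn 1 := by
  have hn0 : 0 < ((n : ℂ) / 2).re := by simpa using hn
  have hG := Gamma_half_natCast_ne_zero hn
  have hV := toSphere_real_univ_ne_zero hn
  have hm : (m.factorial : ℂ) ≠ 0 := by exact_mod_cast m.factorial_ne_zero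
  -- The binomial coefficient is a rising factorial over m!, hence the Gamma quotient produced by
  -- the radial integral.
  have hc : (m.factorial : ℂ) * Ring.choose ((n : ℂ) / 2 + m - 1) m =
      Complex.Gamma ((n : ℂ) / 2 + m) / Complex.Gamma ((n : ℂ) / 2) := by
    rw [Complex.Gamma_add_nat_div_Gamma_eq, ← Ring.multichoose_eq, ← nsmul_eq_mul,
      Ring.factorial_nsmul_multichoose_eq_ascPochhammer, Polynomial.ascPochhammer_smeval_eq_eval]
    intro k hk
    rw [hk] at hn0
    simp at hn0
    linarith [(Nat.cast_nonneg k : (0 : ℝ) ≤ _)]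
  rw [average_eq, gaussianFunctional_eq_integral_toSphere hn p m hp, gaussianFunctional_one,
    Complex.real_smul, Complex.ofReal_inv]
  rw [eq_div_iff hG] at hc
  generalize Ring.choose ((n : ℂ) / 2 + m - 1) m = c at *
  generalize Complex.Gamma ((n : ℂ) / 2 + m) = G at *
  field_simp
  linear_combination (∫ θ : RealSphere n, evalReal p θ.1
    ∂(volume : Measure (EuclideanSpace ℝ (Fin n))).toSphere) * hc

end HuaAronszajn

/-! ### Zeros of the radicand, the Lie norm and the branch of the root -/

namespace HuaAronszajn

/-- The product of `1 - α` and `1 - β` with `|α|, |β| < 1` lies off the negative real axis. -/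
theorem one_sub_mul_one_sub_mem_slitPlane {α β : ℂ} (hα : ‖α‖ < 1) (hβ : ‖β‖ < 1) :
    (1 - α) * (1 - β) ∈ Complex.slitPlane := by
  have h1 : |α.re| ≤ ‖α‖ := Complex.abs_re_le_norm α
  have h2 : |β.re| ≤ ‖β‖ := Complex.abs_re_le_norm β
  have ha : 0 < (1 - α).re := by simp; linarith [le_abs_self α.re]
  have hb : 0 < (1 - β).re := by simp; linarith [le_abs_self β.re]
  generalize 1 - α = a at *
  generalize 1 - β = b at *
  rw [Complex.mem_slitPlane_iff]
  by_contra! h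
  obtain ⟨h1, h2⟩ := h
  simp only [Complex.mul_re, Complex.mul_im] at h1 h2
  -- If Im(ab) = 0, then Re b · Re(ab) = Re a · |b|² > 0, against Re(ab) ≤ 0.
  have h3 : a.im * b.re = - (a.re * b.im) := by linarith
  have h4 : b.re * (a.re * b.re - a.im * b.im) ≤ 0 := mul_nonpos_of_nonneg_of_nonpos hb.le h1
  have h5 : b.re * (a.re * b.re - a.im * b.im) = a.re * (b.re ^ 2 + b.im ^ 2) := by
    linear_combination (-b.im) * h3
  have : 0 < a.re * (b.re ^ 2 + b.im ^ 2) := by positivity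
  linarith

variable {n : ℕ}

theorem sum_sq_sphere (θ : RealSphere n) : ∑ j, (θ.1 j) ^ 2 = 1 := by
  have h : ‖θ.1‖ = 1 := by simp
  have h2 := EuclideanSpace.norm_sq_eq θ.1
  rw [h] at h2
  simpa using h2.symm

/-- Bessel's inequality for an isotropic vector and its complex conjugate. -/
theorem two_mul_norm_realPairing_sq_le (θ : RealSphere n) (y : EuclideanSpace ℂ (Fin n))
    (hy : bilinSq y = 0) : 2 * ‖realPairing θ y‖ ^ 2 ≤ ‖y‖ ^ 2 := by
  set s := realPairing θ y with hs
  -- Multiplying y by the conjugate of s makes its pairing with θ real, so Cauchy–Schwarz can be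
  -- applied to real parts alone.
  have h1 : ∑ j, θ.1 j * ((starRingEnd ℂ) s * y j).re = ‖s‖ ^ 2 := by
    have : (((starRingEnd ℂ) s) * s).re = ‖s‖ ^ 2 := by
      rw [mul_comm, Complex.mul_conj, Complex.ofReal_re, Complex.normSq_eq_norm_sq]
    rw [← this]
    conv_rhs => enter [1, 2]; rw [hs, realPairing]
    rw [Finset.mul_sum, Complex.re_sum]
    refine Finset.sum_congr rfl fun j _ => ?_
    rw [← Complex.re_ofReal_mul]
    congr 1
    ring
  -- Isotropy makes the real part carry exactly half of the squared norm; this is the gain of the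
  -- factor 2.
  have h2 : ∑ j, ((starRingEnd ℂ) s * y j).re ^ 2 = ‖s‖ ^ 2 * ‖y‖ ^ 2 / 2 := by
    have hre (z : ℂ) : z.re ^ 2 = (‖z‖ ^ 2 + (z ^ 2).re) / 2 := by
      rw [← Complex.normSq_eq_norm_sq, Complex.normSq_apply, pow_two z, Complex.mul_re]; ring
    have h0 : ∑ j, (((starRingEnd ℂ) s * y j) ^ 2).re = 0 := by
      rw [← Complex.re_sum]
      simp only [mul_pow]
      rw [← Finset.mul_sum]
      have : ∑ j, y j ^ 2 = 0 := hy
      simp [this]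
    simp only [hre]
    rw [← Finset.sum_div, Finset.sum_add_distrib, h0, EuclideanSpace.norm_sq_eq y, Finset.mul_sum]
    simp [mul_pow]
  have cs := Finset.sum_mul_sq_le_sq_mul_sq Finset.univ (fun j => θ.1 j)
    fun j => ((starRingEnd ℂ) s * y j).re
  rw [h1, h2, sum_sq_sphere] at cs
  rcases (sq_nonneg ‖s‖).eq_or_lt with h | h
  · rw [← h]; simp
  · have : ‖s‖ ^ 2 * (2 * ‖s‖ ^ 2) ≤ ‖s‖ ^ 2 * ‖y‖ ^ 2 := by nlinarith
    exact le_of_mul_le_mul_left this h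

/-- The zeros of `ζ ↦ ζ² - 2ζ⟨θ, x⟩ + x · x` have modulus at most `L(x)`. -/
theorem norm_le_lieNorm_of_root (θ : RealSphere n) (x : EuclideanSpace ℂ (Fin n)) {ζ : ℂ}
    (h : ζ ^ 2 - 2 * ζ * realPairing θ x + bilinSq x = 0) : ‖ζ‖ ≤ lieNorm x := by
  set u := realPairing θ x with hu
  set A := bilinSq x with hA
  -- The equation for ζ says exactly that ζθ - x is isotropic.
  let y : EuclideanSpace ℂ (Fin n) := WithLp.toLp 2 fun j => ζ * θ.1 j - x j
  have hθ : ∑ j, ((θ.1 j : ℂ)) ^ 2 = 1 := by exact_mod_cast congrArg Complex.ofReal (sum_sq_sphere θ)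
  have hy : bilinSq y = 0 := by
    rw [← h, hA, hu]
    simp only [bilinSq, realPairing, y, sub_sq, mul_pow, Finset.sum_add_distrib,
      Finset.sum_sub_distrib, ← Finset.mul_sum, hθ]
    rw [Finset.mul_sum, mul_one]
    congr 2
    · exact Finset.sum_congr rfl fun j _ => by ring
  have hyu : realPairing θ y = ζ - u := by
    rw [hu]
    simp only [realPairing, y, mul_sub, Finset.sum_sub_distrib]
    congr 1
    conv_rhs => rw [← mul_one ζ, ← hθ, Finset.mul_sum]
    exact Finset.sum_congr rfl fun j _ => by ring
  have hyn : ‖y‖ ^ 2 = ‖ζ‖ ^ 2 - 2 * ((starRingEnd ℂ) ζ * u).re + ‖x‖ ^ 2 := by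
    have e (z w : ℂ) (t : ℝ) : ‖z * t - w‖ ^ 2 =
        t ^ 2 * ‖z‖ ^ 2 - 2 * ((starRingEnd ℂ) z * (t * w)).re + ‖w‖ ^ 2 := by
      simp only [← Complex.normSq_eq_norm_sq, Complex.normSq_apply]
      simp
      ring
    rw [EuclideanSpace.norm_sq_eq, EuclideanSpace.norm_sq_eq, hu, realPairing]
    simp only [y, e, Finset.sum_add_distrib, Finset.sum_sub_distrib, ← Finset.mul_sum,
      ← Finset.sum_mul, sum_sq_sphere, one_mul, ← Complex.re_sum]
  have bessel := two_mul_norm_realPairing_sq_le θ y hy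
  rw [hyu, hyn] at bessel
  have hA' : A = 2 * ζ * u - ζ ^ 2 := by linear_combination h
  have hu2 : ‖ζ - u‖ ^ 2 = ‖ζ‖ ^ 2 - 2 * ((starRingEnd ℂ) ζ * u).re + ‖u‖ ^ 2 := by
    simp only [← Complex.normSq_eq_norm_sq, Complex.normSq_apply]
    simp
    ring
  have hAn : ‖A‖ ^ 2 = ‖ζ‖ ^ 2 * (4 * ‖u‖ ^ 2 - 4 * ((starRingEnd ℂ) ζ * u).re + ‖ζ‖ ^ 2) := by
    rw [hA', show 2 * ζ * u - ζ ^ 2 = ζ * (2 * u - ζ) by ring, norm_mul, mul_pow]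
    congr 1
    simp only [← Complex.normSq_eq_norm_sq, Complex.normSq_apply]
    simp
    ring
  -- Bessel's inequality times |ζ|² amounts to |ζ|⁴ + |x·x|² ≤ 2|ζ|²‖x‖²; completing the square
  -- gives this form.
  have key : (‖ζ‖ ^ 2 - ‖x‖ ^ 2) ^ 2 ≤ ‖x‖ ^ 4 - ‖A‖ ^ 2 := by
    rw [hu2] at bessel
    have := mul_le_mul_of_nonneg_left bessel (sq_nonneg ‖ζ‖)
    nlinarith
  rw [lieNorm]
  apply Real.le_sqrt_of_sq_le
  linarith [Real.le_sqrt_of_sq_le key]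

theorem lieNorm_nonneg (x : EuclideanSpace ℂ (Fin n)) : 0 ≤ lieNorm x := Real.sqrt_nonneg _

/-- The radicand of the root stays off the negative real axis where `L(x) < |ζ|`. -/
theorem radicand_mem_slitPlane {ζ : ℂ} (θ : RealSphere n) (x : EuclideanSpace ℂ (Fin n))
    (h : lieNorm x < ‖ζ‖) :
    1 - 2 * realPairing θ x / ζ + bilinSq x / ζ ^ 2 ∈ Complex.slitPlane := by
  have hζ : ζ ≠ 0 := norm_pos_iff.1 ((lieNorm_nonneg x).trans_lt h)
  -- The quadratic has the roots ⟨θ,x⟩ ± s; divided by ζ they are the α and β in the radicand (1 -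
  -- α)(1 - β).
  obtain ⟨s, hs⟩ := IsAlgClosed.exists_pow_nat_eq (realPairing θ x ^ 2 - bilinSq x) two_pos
  have hroot (z : ℂ) (hz : z ^ 2 - 2 * z * realPairing θ x + bilinSq x = 0) : ‖z / ζ‖ < 1 := by
    rw [norm_div, div_lt_one (norm_pos_iff.2 hζ)]
    exact (norm_le_lieNorm_of_root θ x hz).trans_lt h
  have := one_sub_mul_one_sub_mem_slitPlane
    (hroot (realPairing θ x + s) (by linear_combination hs))
    (hroot (realPairing θ x - s) (by linear_combination hs))
  convert this using 1
  field_simp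
  linear_combination hs

theorem aronszajnRoot_ne_zero {ζ : ℂ} (θ : RealSphere n) (x : EuclideanSpace ℂ (Fin n))
    (h : lieNorm x < ‖ζ‖) : aronszajnRoot ζ θ x ≠ 0 := by
  have hζ : ζ ≠ 0 := norm_pos_iff.1 ((lieNorm_nonneg x).trans_lt h)
  rw [aronszajnRoot]
  refine mul_ne_zero hζ fun h0 => ?_
  rw [Complex.cpow_eq_zero_iff] at h0
  exact Complex.slitPlane_ne_zero (radicand_mem_slitPlane θ x h) h0.1

@[fun_prop]
theorem continuous_realPairing :
    Continuous fun p : RealSphere n × EuclideanSpace ℂ (Fin n) => realPairing p.1 p.2 := by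
  unfold realPairing
  fun_prop

@[fun_prop]
theorem continuous_bilinSq : Continuous (bilinSq (n := n)) := by
  unfold bilinSq
  fun_prop

theorem continuousOn_aronszajnRoot :
    ContinuousOn (fun p : ℂ × RealSphere n × EuclideanSpace ℂ (Fin n) =>
      aronszajnRoot p.1 p.2.1 p.2.2) {p | lieNorm p.2.2 < ‖p.1‖} := by
  unfold aronszajnRoot
  have h0 (p : ℂ × RealSphere n × EuclideanSpace ℂ (Fin n))
      (hp : p ∈ {p : ℂ × RealSphere n × EuclideanSpace ℂ (Fin n) | lieNorm p.2.2 < ‖p.1‖}) :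
      p.1 ≠ 0 := norm_pos_iff.1 ((lieNorm_nonneg p.2.2).trans_lt hp)
  have h1 : Continuous fun p : ℂ × RealSphere n × EuclideanSpace ℂ (Fin n) =>
    realPairing p.2.1 p.2.2 := continuous_realPairing.comp continuous_snd
  have h2 : Continuous fun p : ℂ × RealSphere n × EuclideanSpace ℂ (Fin n) =>
    bilinSq p.2.2 := by fun_prop
  refine continuous_fst.continuousOn.mul (ContinuousOn.cpow_const ?_ fun p hp =>
    radicand_mem_slitPlane _ _ hp)
  refine ((continuousOn_const.sub ?_)).add ?_
  · exact (continuous_const.mul h1).continuousOn.div continuous_fst.continuousOn h0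
  · exact h2.continuousOn.div (continuous_fst.pow 2).continuousOn fun p hp => pow_ne_zero 2 (h0 p hp)

/-- The kernel as a negative power of the radicand. -/
theorem huaAronszajnKernel_eq (hn : 0 < n) {ζ : ℂ} (hζ : ζ ≠ 0) (θ : RealSphere n)
    (x : EuclideanSpace ℂ (Fin n)) : huaAronszajnKernel ζ θ x =
      ζ⁻¹ * (1 / (1 - 2 * realPairing θ x / ζ + bilinSq x / ζ ^ 2) ^ ((n : ℂ) / 2)) := by
  rw [huaAronszajnKernel, aronszajnRoot, mul_pow, ← Complex.cpow_nat_mul,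
    show (n : ℂ) * (1 / 2) = n / 2 by ring]
  obtain ⟨k, rfl⟩ : ∃ k, n = k + 1 := ⟨n - 1, by omega⟩
  rw [Nat.add_sub_cancel, pow_succ]
  field_simp

end HuaAronszajn

/-! ### Contour integrals and the binomial series -/

namespace HuaAronszajn

open Filter Topology

/-- If `F` is holomorphic on `{L < |ζ|}` and `F - g` decays like `|ζ|⁻²`, where all circle
integrals of `g` are equal to `c`, then so are those of `F`. -/
theorem circleIntegral_eq_of_norm_sub_le {F g : ℂ → ℂ} {c : ℂ} {L R C S₀ : ℝ} (hL : 0 ≤ L)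
    (hR : L < R) (hF : ∀ ζ, L < ‖ζ‖ → DifferentiableAt ℂ F ζ)
    (hg : ∀ S > 0, CircleIntegrable g 0 S) (hc : ∀ S > 0, (∮ ζ in C(0, S), g ζ) = c)
    (hFg : ∀ ζ, S₀ < ‖ζ‖ → ‖F ζ - g ζ‖ ≤ C / ‖ζ‖ ^ 2) : (∮ ζ in C(0, R), F ζ) = c := by
  have hcont (S : ℝ) (hS : L < S) : CircleIntegrable F 0 S := by
    refine ContinuousOn.circleIntegrable (hL.trans hS.le) fun ζ hζ => ?_
    rw [mem_sphere_zero_iff_norm] at hζ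
    exact (hF ζ (hζ ▸ hS)).continuousAt.continuousWithinAt
  have hbound : ∀ᶠ S : ℝ in atTop, ‖(∮ ζ in C(0, R), F ζ) - c‖ ≤ 2 * Real.pi * C / S := by
    filter_upwards [eventually_ge_atTop R, eventually_gt_atTop S₀] with S hS hS0
    have hSpos : 0 < S := by linarith
    -- The contour moves out to radius S; there the difference integrates to at most 2πC/S, which
    -- tends to 0.
    have hann : (∮ ζ in C(0, S), F ζ) = ∮ ζ in C(0, R), F ζ := by
      refine Complex.circleIntegral_eq_of_differentiable_on_annulus_off_countable
        (by linarith) hS Set.countable_empty ?_ ?_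
      · intro ζ hζ
        have : R ≤ ‖ζ‖ := by simpa using hζ.2
        exact (hF ζ (by linarith)).continuousAt.continuousWithinAt
      · intro ζ hζ
        have : R < ‖ζ‖ := by simpa using hζ.1.2
        exact hF ζ (by linarith)
    rw [← hann, ← hc S hSpos, ← circleIntegral.integral_sub (hcont S (by linarith)) (hg S hSpos)]
    refine (circleIntegral.norm_integral_le_of_norm_le_const hSpos.le (C := C / S ^ 2)
      fun ζ hζ => ?_).trans (le_of_eq ?_)
    · rw [mem_sphere_zero_iff_norm] at hζ
      rw [← hζ]
      exact hFg ζ (hζ ▸ hS0)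
    · field_simp
  have hlim : Tendsto (fun S : ℝ => 2 * Real.pi * C / S) atTop (𝓝 0) :=
    tendsto_const_nhds.div_atTop tendsto_id
  exact sub_eq_zero.1 (norm_le_zero_iff.1 (ge_of_tendsto hlim hbound))

theorem circleIntegrable_pow_mul_eval_inv (p : Polynomial ℂ) (k : ℕ) {R : ℝ} (hR : 0 < R) :
    CircleIntegrable (fun ζ => ζ ^ k * (ζ⁻¹ * p.eval ζ⁻¹)) 0 R := by
  refine ContinuousOn.circleIntegrable hR.le ?_
  have h : ContinuousOn (fun ζ : ℂ => ζ⁻¹) (Metric.sphere 0 R) :=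
    continuousOn_inv₀.mono fun ζ hζ => norm_pos_iff.1 (mem_sphere_zero_iff_norm.1 hζ ▸ hR)
  exact (continuous_pow k).continuousOn.mul (h.mul (p.continuous.comp_continuousOn h))

theorem circleIntegral_pow_mul_eval_inv (p : Polynomial ℂ) (k : ℕ) {R : ℝ} (hR : 0 < R) :
    (∮ ζ in C(0, R), ζ ^ k * (ζ⁻¹ * p.eval ζ⁻¹)) = 2 * Real.pi * Complex.I * p.coeff k := by
  induction p using Polynomial.induction_on' with
  | add p q hp hq =>
    simp only [Polynomial.eval_add, mul_add, Polynomial.coeff_add]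
    rw [circleIntegral.integral_add (circleIntegrable_pow_mul_eval_inv p k hR)
      (circleIntegrable_pow_mul_eval_inv q k hR), hp, hq]
  | monomial j a =>
    have h : (∮ ζ in C(0, R), ζ ^ k * (ζ⁻¹ * (Polynomial.monomial j a).eval ζ⁻¹)) =
        ∮ ζ in C(0, R), a * (ζ - 0) ^ ((k : ℤ) - 1 - j) := by
      refine circleIntegral.integral_congr hR.le fun ζ hζ => ?_
      have hζ0 : ζ ≠ 0 := norm_pos_iff.1 (mem_sphere_zero_iff_norm.1 hζ ▸ hR)
      simp only [Polynomial.eval_monomial, sub_zero, zpow_sub₀ hζ0, zpow_natCast, zpow_one, inv_pow]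
      field_simp
    rw [h, circleIntegral.integral_const_mul, Polynomial.coeff_monomial]
    split_ifs with hjk
    · subst hjk
      have : (∮ ζ in C(0, R), (ζ - 0) ^ ((j : ℤ) - 1 - j)) = 2 * Real.pi * Complex.I := by
        simpa using circleIntegral.integral_sub_center_inv 0 hR.ne'
      rw [this, mul_comm]
    · rw [circleIntegral.integral_sub_zpow_of_ne (by omega)]
      simp

/-- Circle integrals of `ζ ^ (k - 1) (1 - D(1/ζ)) ^ (-a)` for a polynomial `D` without constant
term, in terms of the binomial series. -/
theorem circleIntegral_pow_mul_one_div_one_sub_cpow (D : Polynomial ℂ) (hD : D.eval 0 = 0) (a : ℂ)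
    {L R : ℝ} (hL : 0 ≤ L) (hR : L < R)
    (hs : ∀ ζ : ℂ, L < ‖ζ‖ → 1 - D.eval ζ⁻¹ ∈ Complex.slitPlane) (k : ℕ) :
    (∮ ζ in C(0, R), ζ ^ k * (ζ⁻¹ * (1 / (1 - D.eval ζ⁻¹) ^ a))) =
      2 * Real.pi * Complex.I *
        ∑ m ∈ Finset.range (k + 1), Ring.choose (a + m - 1) m * (D ^ m).coeff k := by
  -- Since D(w) = O(w), stopping at m = k leaves an error O(|w|^(k+1)). With w = 1/ζ and the factor
  -- ζ^(k-1) this is O(|ζ|⁻²), as the comparison of contours requires.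
  set p : Polynomial ℂ :=
    ∑ m ∈ Finset.range (k + 1), Polynomial.C (Ring.choose (a + m - 1) m) * D ^ m with hp
  have hpk : p.coeff k =
      ∑ m ∈ Finset.range (k + 1), Ring.choose (a + m - 1) m * (D ^ m).coeff k := by
    simp [hp]
  have hbig : (fun w : ℂ => 1 / (1 - D.eval w) ^ a - p.eval w) =O[𝓝 0] fun w => ‖w‖ ^ (k + 1) := by
    have hD0 : Tendsto (fun w => D.eval w) (𝓝 0) (𝓝 0) := by
      simpa [hD] using D.continuous.tendsto (0 : ℂ)
    have h1 := ((Complex.one_div_one_sub_cpow_hasFPowerSeriesOnBall_zero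
      a).hasFPowerSeriesAt.isBigO_sub_partialSum_pow (k + 1)).comp_tendsto hD0
    have h2 : (fun w => ‖D.eval w‖ ^ (k + 1)) =O[𝓝 0] fun w => ‖w‖ ^ (k + 1) := by
      have := (D.differentiableAt (x := (0 : ℂ))).isBigO_sub
      simp only [hD, sub_zero] at this
      exact this.norm_norm.pow (k + 1)
    refine (h1.trans h2).congr_left fun w => ?_
    simp [hp, FormalMultilinearSeries.partialSum, Polynomial.eval_finsetSum, mul_comm]
  obtain ⟨C, hC⟩ := hbig.bound
  obtain ⟨δ, hδ, hball⟩ := Metric.eventually_nhds_iff.1 hC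
  rw [← hpk]
  refine circleIntegral_eq_of_norm_sub_le (g := fun ζ => ζ ^ k * (ζ⁻¹ * p.eval ζ⁻¹)) (C := C)
    (S₀ := δ⁻¹) hL hR (fun ζ hζ => ?_) (fun S hS => circleIntegrable_pow_mul_eval_inv p k hS)
    (fun S hS => circleIntegral_pow_mul_eval_inv p k hS) fun ζ hζ => ?_
  · have hζ0 : ζ ≠ 0 := norm_pos_iff.1 (hL.trans_lt hζ)
    have hinv : DifferentiableAt ℂ (fun ζ : ℂ => ζ⁻¹) ζ := differentiableAt_inv hζ0
    have hDd : DifferentiableAt ℂ (fun ζ : ℂ => 1 - D.eval ζ⁻¹) ζ :=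
      (D.differentiableAt.comp ζ hinv).const_sub 1
    refine (differentiableAt_pow k).mul (hinv.mul ((differentiableAt_const 1).div
      (hDd.cpow_const (hs ζ hζ)) ?_))
    rw [Ne, Complex.cpow_eq_zero_iff]
    exact fun h => Complex.slitPlane_ne_zero (hs ζ hζ) h.1
  · have hpos : 0 < ‖ζ‖ := (inv_pos.2 hδ).trans hζ
    have hw := hball (y := ζ⁻¹) (by
      rw [dist_zero_right, norm_inv]
      exact inv_lt_of_inv_lt₀ hδ hζ)
    rw [← mul_sub, ← mul_sub, norm_mul, norm_mul, norm_pow, norm_inv]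
    rw [Real.norm_of_nonneg (by positivity), norm_inv] at hw
    calc ‖ζ‖ ^ k * (‖ζ‖⁻¹ * ‖1 / (1 - D.eval ζ⁻¹) ^ a - p.eval ζ⁻¹‖)
        ≤ ‖ζ‖ ^ k * (‖ζ‖⁻¹ * (C * ‖ζ‖⁻¹ ^ (k + 1))) := by gcongr
      _ = C / ‖ζ‖ ^ 2 := by
        rw [inv_pow]
        field_simp
        ring

end HuaAronszajn

/-! ### Reproduction of homogeneous polynomials and the Cauchy formula -/

namespace HuaAronszajn

open MvPolynomial Finset

variable {n : ℕ}

/-- The polynomial `2⟨y, x⟩ t - (x · x) t²` in `t` for a fixed real vector `y`. -/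
def hermiteExponentAt (x : Fin n → ℂ) (y : EuclideanSpace ℝ (Fin n)) : Polynomial ℂ :=
  (hermiteExponent x).map (eval fun j => (y j : ℂ))

theorem hermiteExponentAt_eq (x : Fin n → ℂ) (y : EuclideanSpace ℝ (Fin n)) :
    hermiteExponentAt x y = Polynomial.C (2 * ∑ j, (y j : ℂ) * x j) * Polynomial.X -
      Polynomial.C (∑ j, x j ^ 2) * Polynomial.X ^ 2 := by
  have h2 : eval (fun j => (y j : ℂ)) (2 : MvPolynomial (Fin n) ℂ) = 2 := map_ofNat _ 2
  have hu : eval (fun j => (y j : ℂ)) (linearForm x) = ∑ j, (y j : ℂ) * x j := by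
    simp [linearForm, mul_comm]
  simp only [hermiteExponentAt, hermiteExponent, Polynomial.map_sub, Polynomial.map_mul,
    Polynomial.map_pow, Polynomial.map_C, Polynomial.map_X]
  rw [map_mul (eval fun j => (y j : ℂ)), h2, hu, eval_C]

theorem evalReal_coeff_hermiteExponent_pow (x : Fin n → ℂ) (m k : ℕ)
    (y : EuclideanSpace ℝ (Fin n)) :
    evalReal ((hermiteExponent x ^ m).coeff k) y = (hermiteExponentAt x y ^ m).coeff k := by
  rw [hermiteExponentAt, ← Polynomial.map_pow, Polynomial.coeff_map, evalReal]

/-- Replacing y by ry and t by rt multiplies the exponent by r². Keeping r^k on the left avoids the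
subtraction 2m - k. -/
theorem evalReal_coeff_hermiteExponent_pow_smul (x : Fin n → ℂ) (m k : ℕ) (r : ℝ)
    (y : EuclideanSpace ℝ (Fin n)) :
    (r : ℂ) ^ k * evalReal ((hermiteExponent x ^ m).coeff k) (r • y) =
      (r : ℂ) ^ (2 * m) * evalReal ((hermiteExponent x ^ m).coeff k) y := by
  have h : (hermiteExponentAt x (r • y)).comp (Polynomial.C (r : ℂ) * Polynomial.X) =
      Polynomial.C ((r : ℂ) ^ 2) * hermiteExponentAt x y := by
    have e : ∑ j, ((r • y) j : ℂ) * x j = r * ∑ j, (y j : ℂ) * x j := by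
      simp [mul_sum, mul_assoc]
    rw [hermiteExponentAt_eq, hermiteExponentAt_eq, e]
    generalize ∑ j, (y j : ℂ) * x j = u
    generalize ∑ j, x j ^ 2 = A
    simp
    ring
  rw [evalReal_coeff_hermiteExponent_pow, evalReal_coeff_hermiteExponent_pow, mul_comm,
    ← Polynomial.comp_C_mul_X_coeff, Polynomial.pow_comp, h, mul_pow, ← Polynomial.C_pow,
    Polynomial.coeff_C_mul, pow_mul]

theorem eval_mul_of_isHomogeneous {p : MvPolynomial (Fin n) ℂ} {k : ℕ} (hp : p.IsHomogeneous k)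
    (c : ℂ) (v : Fin n → ℂ) : eval (fun j => c * v j) p = c ^ k * eval v p := by
  rw [eval_eq', eval_eq', mul_sum]
  refine sum_congr rfl fun d hd => ?_
  have hdk : ∑ i, d i = k := by
    rw [← hp (mem_support_iff.1 hd), Finsupp.weight_apply, Finsupp.sum_fintype _ _ (by simp)]
    simp
  simp only [mul_pow, prod_mul_distrib, prod_pow_eq_pow_sum, hdk]
  ring

/-- The coefficients of the kernel reproduce homogeneous polynomials by integration over the
sphere. -/
theorem sum_choose_mul_average (hn : 0 < n) (x : Fin n → ℂ) {p : MvPolynomial (Fin n) ℂ} {k : ℕ}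
    (hp : p.IsHomogeneous k) :
    ∑ m ∈ range (k + 1), Ring.choose ((n : ℂ) / 2 + m - 1) m *
      (⨍ θ : RealSphere n, evalReal ((hermiteExponent x ^ m).coeff k * p) θ.1
        ∂(volume : Measure (EuclideanSpace ℝ (Fin n))).toSphere) = eval x p := by
  have h (m : ℕ) := choose_mul_average_toSphere_evalReal hn ((hermiteExponent x ^ m).coeff k * p) m
    fun r y hr => by
      have h1 := evalReal_coeff_hermiteExponent_pow_smul x m k r y
      have h2 : evalReal p (r • y) = (r : ℂ) ^ k * evalReal p y := by
        rw [evalReal, evalReal, ← eval_mul_of_isHomogeneous hp]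
        simp
      have e (q : MvPolynomial (Fin n) ℂ) (z) : evalReal (q * p) z = evalReal q z * evalReal p z := by
        simp [evalReal]
      rw [e, e, h2]
      linear_combination evalReal p y * h1
  have key := apply_hermite_mul (gaussianFunctional hn) (gaussianFunctional_X_mul hn) x k k p le_rfl hp
  rw [if_pos rfl, hermite, sum_mul, map_sum] at key
  rw [sum_congr rfl fun m _ => h m, ← sum_div, div_eq_iff (gaussianFunctional_one_ne_zero hn), ← key]
  refine sum_congr rfl fun m _ => ?_
  rw [mul_assoc, ← smul_eq_C_mul, map_smul, smul_eq_mul]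

theorem eval_mul_real_eq_sum (P : MvPolynomial (Fin n) ℂ) (ζ : ℂ) (y : EuclideanSpace ℝ (Fin n)) :
    eval (fun j => ζ * (y j : ℂ)) P =
      ∑ k ∈ range (P.totalDegree + 1), ζ ^ k * evalReal (homogeneousComponent k P) y := by
  conv_lhs => rw [← sum_homogeneousComponent P, map_sum]
  exact sum_congr rfl fun k _ =>
    eval_mul_of_isHomogeneous (homogeneousComponent_isHomogeneous k P) ζ _

variable (x : EuclideanSpace ℂ (Fin n)) {R : ℝ}

theorem huaAronszajnKernel_eq_hermiteExponentAt (hn : 0 < n) {ζ : ℂ} (hζ : ζ ≠ 0)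
    (θ : RealSphere n) : huaAronszajnKernel ζ θ x =
      ζ⁻¹ * (1 / (1 - (hermiteExponentAt (fun j => x j) θ.1).eval ζ⁻¹) ^ ((n : ℂ) / 2)) := by
  rw [huaAronszajnKernel_eq hn hζ, hermiteExponentAt_eq]
  congr 3
  simp only [Polynomial.eval_sub, Polynomial.eval_mul, Polynomial.eval_C, Polynomial.eval_X,
    Polynomial.eval_pow, realPairing, bilinSq]
  field_simp
  ring

theorem continuousOn_huaAronszajnKernel :
    ContinuousOn (fun p : ℂ × RealSphere n => huaAronszajnKernel p.1 p.2 x)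
      {p | lieNorm x < ‖p.1‖} := by
  unfold huaAronszajnKernel
  have h : ContinuousOn (fun p : ℂ × RealSphere n => aronszajnRoot p.1 p.2 x)
      {p | lieNorm x < ‖p.1‖} :=
    continuousOn_aronszajnRoot.comp (f := fun p : ℂ × RealSphere n => (p.1, p.2, x))
      (by fun_prop) fun p hp => hp
  exact (continuous_fst.pow _).continuousOn.div (h.pow n)
    fun p hp => pow_ne_zero n (aronszajnRoot_ne_zero p.2 x hp)

theorem continuous_circleMap_huaAronszajnKernel_mul (P : MvPolynomial (Fin n) ℂ)
    (hR : lieNorm x < R) :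
    Continuous fun p : ℝ × RealSphere n => huaAronszajnKernel (circleMap 0 R p.1) p.2 x *
      eval (fun j => circleMap 0 R p.1 * (p.2.1 j : ℂ)) P := by
  refine Continuous.mul ?_ ?_
  · refine (continuousOn_huaAronszajnKernel x).comp_continuous
      (f := fun p : ℝ × RealSphere n => (circleMap 0 R p.1, p.2)) ?_ fun p => ?_
    · exact ((continuous_circleMap 0 R).comp continuous_fst).prodMk continuous_snd
    · rw [Set.mem_ofPred_eq, norm_circleMap_zero]
      exact hR.trans_le (le_abs_self R)
  · refine (MvPolynomial.continuous_eval P).comp (continuous_pi fun j => ?_)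
    exact ((continuous_circleMap 0 R).comp continuous_fst).mul (by fun_prop)

theorem circleIntegral_pow_mul_huaAronszajnKernel (hn : 0 < n) (hR : lieNorm x < R)
    (θ : RealSphere n) (k : ℕ) :
    (∮ ζ in C(0, R), ζ ^ k * huaAronszajnKernel ζ θ x) = 2 * Real.pi * Complex.I *
      ∑ m ∈ range (k + 1), Ring.choose ((n : ℂ) / 2 + m - 1) m *
        evalReal ((hermiteExponent (fun j => x j) ^ m).coeff k) θ.1 := by
  have hRpos : 0 < R := (lieNorm_nonneg x).trans_lt hR
  simp only [evalReal_coeff_hermiteExponent_pow]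
  rw [← circleIntegral_pow_mul_one_div_one_sub_cpow _ _ _ (lieNorm_nonneg x) hR]
  · refine circleIntegral.integral_congr hRpos.le fun ζ hζ => ?_
    have hζ0 : ζ ≠ 0 := norm_pos_iff.1 (mem_sphere_zero_iff_norm.1 hζ ▸ hRpos)
    simp only [huaAronszajnKernel_eq_hermiteExponentAt x hn hζ0]
  · intro ζ hζ
    have hζ0 : ζ ≠ 0 := norm_pos_iff.1 ((lieNorm_nonneg x).trans_lt hζ)
    convert radicand_mem_slitPlane θ x hζ using 1
    rw [hermiteExponentAt_eq]
    simp only [Polynomial.eval_sub, Polynomial.eval_mul, Polynomial.eval_C, Polynomial.eval_X,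
      Polynomial.eval_pow, realPairing, bilinSq]
    field_simp
    ring
  · simp [hermiteExponentAt_eq]

theorem circleIntegrable_pow_mul_huaAronszajnKernel (hR : lieNorm x < R) (θ : RealSphere n) (k : ℕ) :
    CircleIntegrable (fun ζ => ζ ^ k * huaAronszajnKernel ζ θ x) 0 R := by
  have hRpos : 0 < R := (lieNorm_nonneg x).trans_lt hR
  refine ContinuousOn.circleIntegrable hRpos.le ((continuous_pow k).continuousOn.mul ?_)
  refine (continuousOn_huaAronszajnKernel x).comp (f := fun ζ : ℂ => (ζ, θ)) (by fun_prop)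
    fun ζ hζ => ?_
  rw [Set.mem_ofPred_eq, mem_sphere_zero_iff_norm.1 hζ]
  exact hR

theorem circleIntegral_huaAronszajnKernel_mul_eval (hn : 0 < n) (P : MvPolynomial (Fin n) ℂ)
    (hR : lieNorm x < R) (θ : RealSphere n) :
    (∮ ζ in C(0, R), huaAronszajnKernel ζ θ x * eval (fun j => ζ * (θ.1 j : ℂ)) P) =
      2 * Real.pi * Complex.I * ∑ k ∈ range (P.totalDegree + 1), ∑ m ∈ range (k + 1),
        Ring.choose ((n : ℂ) / 2 + m - 1) m *
          evalReal ((hermiteExponent (fun j => x j) ^ m).coeff k * homogeneousComponent k P) θ.1 := by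
  have e (ζ : ℂ) : huaAronszajnKernel ζ θ x * eval (fun j => ζ * (θ.1 j : ℂ)) P =
      ∑ k ∈ range (P.totalDegree + 1), evalReal (homogeneousComponent k P) θ.1 *
        (ζ ^ k * huaAronszajnKernel ζ θ x) := by
    rw [eval_mul_real_eq_sum, mul_sum]
    exact sum_congr rfl fun k _ => by ring
  simp only [e]
  have hint (k : ℕ) : CircleIntegrable (fun ζ => evalReal (homogeneousComponent k P) θ.1 *
      (ζ ^ k * huaAronszajnKernel ζ θ x)) 0 R :=
    (circleIntegrable_pow_mul_huaAronszajnKernel x hR θ k).const_smul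
  rw [circleIntegral.integral_fun_sum fun k _ => hint k, mul_sum]
  refine sum_congr rfl fun k _ => ?_
  rw [circleIntegral.integral_const_mul, circleIntegral_pow_mul_huaAronszajnKernel x hn hR,
    mul_left_comm, mul_sum]
  congr 1
  refine sum_congr rfl fun m _ => ?_
  simp only [evalReal, map_mul]
  ring

theorem circleIntegral_average_comm {μ : Measure (RealSphere n)} [IsFiniteMeasure μ]
    (f : ℂ → RealSphere n → ℂ)
    (hf : Continuous fun p : ℝ × RealSphere n => f (circleMap 0 R p.1) p.2) :
    (∮ ζ in C(0, R), ⨍ θ, f ζ θ ∂μ) = ⨍ θ, (∮ ζ in C(0, R), f ζ θ) ∂μ := by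
  have hd : Continuous (deriv (circleMap 0 R)) := by
    simp only [funext (deriv_circleMap 0 R)]
    exact (continuous_circleMap 0 R).mul continuous_const
  have hc : Continuous (Function.uncurry fun (t : ℝ) (θ : RealSphere n) =>
      deriv (circleMap 0 R) t • f (circleMap 0 R t) θ) := (hd.comp continuous_fst).smul hf
  have hint : Integrable (Function.uncurry fun (t : ℝ) (θ : RealSphere n) =>
      deriv (circleMap 0 R) t • f (circleMap 0 R t) θ)
      ((volume.restrict (Set.uIoc 0 (2 * Real.pi))).prod μ) := by
    -- Continuity gives integrability on the compact product with the closed interval; restriction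
    -- to the half-open one follows.
    have h : IntegrableOn (Function.uncurry fun (t : ℝ) (θ : RealSphere n) =>
        deriv (circleMap 0 R) t • f (circleMap 0 R t) θ)
        (Set.uIcc 0 (2 * Real.pi) ×ˢ Set.univ) (volume.prod μ) :=
      hc.continuousOn.integrableOn_compact (isCompact_uIcc.prod isCompact_univ)
    rw [IntegrableOn, ← Measure.prod_restrict, Measure.restrict_univ] at h
    exact h.mono_measure (Measure.prod_mono (Measure.restrict_mono Set.uIoc_subset_uIcc le_rfl) le_rfl)
  simp only [average_eq, circleIntegral]
  rw [← intervalIntegral_integral_swap hint, ← intervalIntegral.integral_smul]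
  simp only [integral_smul]
  exact intervalIntegral.integral_congr fun t _ => smul_comm _ _ _

theorem cauchy_formula (hn : 0 < n) (P : MvPolynomial (Fin n) ℂ) (hR : lieNorm x < R) :
    eval (fun j => x j) P = (2 * (Real.pi : ℂ) * Complex.I)⁻¹ *
      ∮ ζ in C(0, R), ⨍ θ : RealSphere n,
        huaAronszajnKernel ζ θ x * eval (fun j => ζ * (θ.1 j : ℂ)) P
          ∂((volume : Measure (EuclideanSpace ℝ (Fin n))).toSphere) := by
  rw [circleIntegral_average_comm _ (continuous_circleMap_huaAronszajnKernel_mul x P hR)]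
  simp only [circleIntegral_huaAronszajnKernel_mul_eval x hn P hR]
  have hint (p : MvPolynomial (Fin n) ℂ) : Integrable (fun θ : RealSphere n => evalReal p θ.1)
      ((volume : Measure (EuclideanSpace ℝ (Fin n))).toSphere) :=
    ((continuous_evalReal p).comp continuous_subtype_val).integrable_of_hasCompactSupport
      (HasCompactSupport.of_compactSpace _)
  have hpi : 2 * (Real.pi : ℂ) * Complex.I ≠ 0 := Complex.two_pi_I_ne_zero
  conv_lhs => rw [← sum_homogeneousComponent P, map_sum]
  rw [average_eq, integral_const_mul, integral_finsetSum _ fun k _ => integrable_finsetSum _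
    fun m _ => (hint _).const_mul _, mul_smul_comm, inv_mul_cancel_left₀ hpi, smul_sum]
  refine sum_congr rfl fun k _ => ?_
  rw [← sum_choose_mul_average hn (fun j => x j) (homogeneousComponent_isHomogeneous k P),
    integral_finsetSum _ fun m _ => (hint _).const_mul _, smul_sum]
  refine sum_congr rfl fun m _ => ?_
  rw [integral_const_mul, average_eq, mul_smul_comm]

end HuaAronszajn

end

theorem mainTheorem6 (n : ℕ) (hn : 2 ≤ n) :
    -- the root is a continuous branch without zeros wherever `L(x) < |ζ|`
    (ContinuousOn
        (fun p : ℂ × RealSphere n × EuclideanSpace ℂ (Fin n) =>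
          aronszajnRoot p.1 p.2.1 p.2.2)
        {p | lieNorm p.2.2 < ‖p.1‖} ∧
      ∀ (ζ : ℂ) (θ : RealSphere n) (x : EuclideanSpace ℂ (Fin n)),
        lieNorm x < ‖ζ‖ → aronszajnRoot ζ θ x ≠ 0) ∧
    -- the Cauchy formula; `⨍` integrates against the normalized surface measure
    ∀ (P : MvPolynomial (Fin n) ℂ) (x : EuclideanSpace ℂ (Fin n)) (R : ℝ), lieNorm x < R →
      MvPolynomial.eval (fun j => x j) P =
        (2 * (Real.pi : ℂ) * Complex.I)⁻¹ *
          ∮ ζ in C(0, R),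
            ⨍ θ : RealSphere n,
              huaAronszajnKernel ζ θ x * MvPolynomial.eval (fun j => ζ * (θ.1 j : ℂ)) P
              ∂((volume : Measure (EuclideanSpace ℝ (Fin n))).toSphere) :=
  ⟨⟨HuaAronszajn.continuousOn_aronszajnRoot,
    fun _ θ x h => HuaAronszajn.aronszajnRoot_ne_zero θ x h⟩,
    fun P x _ hR => HuaAronszajn.cauchy_formula x (by omega) P hR⟩
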